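/- Let $M$ be a complex reductive monoid with zero, that is, an irreducible affine algebraic monoid over $\mathbb{C}$ (an affine variety with an associative multiplication $M\times M\to M$ that is a morphism of varieties and has a unit) which has a zero element $0$ and whose unit group $G$ is a connected reductive algebraic group. Let $B$ be a Borel subgroup of $G$ (a maximal closed connected solvable subgroup), let $\overline{B}$ be the Zariski closure of $B$ in $M$, and put $$\overline{B}^{nil} := \{\, x\in \overline{B} : x^m = 0 \text{ for some integer } m\geq 1 \,\}.$$ Then $\overline{B}^{nil}$ is an algebraic subsemigroup of $M$, that is, it is Zariski closed in $M$ and $xy\in \overline{B}^{nil}$ for all $x,y\in\overline{B}^{nil}$. Moreover it is $B\times B$-stable: $b_1 x b_2^{-1}\in \overline{B}^{nil}$ for all $b_1,b_2\in B$ and $x\in\overline{B}^{nil}$. -/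

import Mathlib

open scoped Topology

/-- An affine variety over `K` (meant for `K` algebraically closed) with underlying set of points
`X`, given by its algebra of regular functions: a finitely generated algebra of `K`-valued functions
on `X` such that the points of `X` are exactly the `K`-algebra homomorphisms to `K`. -/
structure AffineVariety (K : Type*) [Field K] (X : Type*) where
  /-- The coordinate algebra `K[X]`. -/
  coord : Subalgebra K (X → K)
  fg : coord.FG
  eval_injective : ∀ x y : X, (∀ f ∈ coord, f x = f y) → x = y
  eval_surjective : ∀ φ : coord →ₐ[K] K, ∃ x : X, ∀ f : coord, φ f = (f : X → K) x

namespace AffineVariety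

variable {K : Type*} [Field K] {X Y : Type*}

/-- The common zeros of a set of functions. -/
def zeros (F : Set (X → K)) : Set X := {x | ∀ f ∈ F, f x = 0}

/-- The Zariski topology: the closed sets are the common zero sets of regular functions. -/
@[reducible] def zariski (A : AffineVariety K X) : TopologicalSpace X :=
  TopologicalSpace.ofClosed {S | ∃ F : Set (X → K), F ⊆ A.coord ∧ S = zeros F}
    ⟨{1}, by simp, by ext; simp [zeros]⟩
    (by
      intro 𝒮 h𝒮
      refine ⟨{f | f ∈ A.coord ∧ ∃ S ∈ 𝒮, ∀ x ∈ S, f x = 0}, fun f hf => hf.1, ?_⟩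
      ext x
      constructor
      · rintro hx f ⟨-, S, hS, hf⟩
        exact hf x (hx S hS)
      · intro hx S hS
        obtain ⟨F, hF, rfl⟩ := h𝒮 hS
        exact fun f hf => hx f ⟨hF hf, _, hS, fun y hy => hy f hf⟩)
    (by
      rintro _ ⟨F, hF, rfl⟩ _ ⟨F', hF', rfl⟩
      refine ⟨{h | ∃ f ∈ F, ∃ f' ∈ F', h = f * f'}, ?_, ?_⟩
      · rintro _ ⟨f, hf, f', hf', rfl⟩
        exact A.coord.mul_mem (hF hf) (hF' hf')
      · ext x
        constructor
        · rintro (hx | hx) _ ⟨f, hf, f', hf', rfl⟩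
          · simp [hx f hf]
          · simp [hx f' hf']
        · intro hx
          by_contra hcon
          simp only [Set.mem_union, not_or, zeros, Set.mem_ofPred_eq, not_forall] at hcon
          obtain ⟨⟨f, hf, hfx⟩, f', hf', hfx'⟩ := hcon
          exact mul_ne_zero hfx hfx' (hx _ ⟨f, hf, f', hf', rfl⟩))

/-- The coordinate algebra of the product variety `X × Y`, that is `K[X] ⊗ K[Y]` as an algebra of
functions. -/
def prodCoord (A : AffineVariety K X) (A' : AffineVariety K Y) : Subalgebra K (X × Y → K) :=
  Algebra.adjoin K
    ({F | ∃ f ∈ A.coord, F = fun p => f p.1} ∪ {F | ∃ f ∈ A'.coord, F = fun p => f p.2})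

end AffineVariety

/-- An affine (equivalently, linear) algebraic monoid structure on the monoid `M`: an affine variety
structure on `M` for which the multiplication `M × M → M` is a morphism of varieties. -/
structure AffineMonoid (K : Type*) [Field K] (M : Type*) [Monoid M] extends
    AffineVariety K M where
  mul_regular : ∀ f ∈ coord,
    (fun p : M × M => f (p.1 * p.2)) ∈ toAffineVariety.prodCoord toAffineVariety

/-- An affine algebraic group structure on the group `G`. -/
structure AffineGroup (K : Type*) [Field K] (G : Type*) [Group G] extends AffineMonoid K G where
  inv_regular : ∀ f ∈ coord, (fun g : G => f g⁻¹) ∈ coord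

namespace AffineMonoid

variable {K : Type*} [Field K] {M : Type*} [Monoid M]

/-- The coordinate algebra of the unit group: the functions on `Mˣ` induced by the embedding
`g ↦ (g, g⁻¹)` of `Mˣ` as the closed subset `{(x, y) | x y = y x = 1}` of `M × M`. -/
def unitsCoord (A : AffineMonoid K M) : Subalgebra K (Mˣ → K) :=
  Algebra.adjoin K
    ({F | ∃ f ∈ A.coord, F = fun g : Mˣ => f g} ∪
      {F | ∃ f ∈ A.coord, F = fun g : Mˣ => f (g⁻¹ : Mˣ)})

theorem diag_mem_unitsCoord (A : AffineMonoid K M) {F : M × M → K}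
    (hF : F ∈ A.prodCoord A.toAffineVariety) :
    (fun g : Mˣ => F ((g : M), ((g⁻¹ : Mˣ) : M))) ∈ A.unitsCoord := by
  induction hF using Algebra.adjoin_induction with
  | mem F hF =>
    rcases hF with ⟨f, hf, rfl⟩ | ⟨f, hf, rfl⟩
    · exact Algebra.subset_adjoin (Or.inl ⟨f, hf, rfl⟩)
    · exact Algebra.subset_adjoin (Or.inr ⟨f, hf, rfl⟩)
  | algebraMap r => exact A.unitsCoord.algebraMap_mem r
  | add _ _ _ _ h h' => exact A.unitsCoord.add_mem h h'
  | mul _ _ _ _ h h' => exact A.unitsCoord.mul_mem h h'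

theorem mul_mem_of_mem_unitsCoord (A : AffineMonoid K M) {P : Subalgebra K (Mˣ × Mˣ → K)}
    (hP : ∀ F ∈ A.unitsCoord, (fun p : Mˣ × Mˣ => F p.1) ∈ P ∧ (fun p : Mˣ × Mˣ => F p.2) ∈ P)
    {F : Mˣ → K} (hF : F ∈ A.unitsCoord) : (fun p : Mˣ × Mˣ => F (p.1 * p.2)) ∈ P := by
  have key : ∀ H ∈ A.prodCoord A.toAffineVariety,
      (fun p : Mˣ × Mˣ => H ((p.1 : M), (p.2 : M))) ∈ P ∧
      (fun p : Mˣ × Mˣ => H (((p.2⁻¹ : Mˣ) : M), ((p.1⁻¹ : Mˣ) : M))) ∈ P := by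
    intro H hH
    induction hH using Algebra.adjoin_induction with
    | mem H hH =>
      rcases hH with ⟨f, hf, rfl⟩ | ⟨f, hf, rfl⟩
      · exact ⟨(hP _ (Algebra.subset_adjoin (Or.inl ⟨f, hf, rfl⟩))).1,
          (hP _ (Algebra.subset_adjoin (Or.inr ⟨f, hf, rfl⟩))).2⟩
      · exact ⟨(hP _ (Algebra.subset_adjoin (Or.inl ⟨f, hf, rfl⟩))).2,
          (hP _ (Algebra.subset_adjoin (Or.inr ⟨f, hf, rfl⟩))).1⟩
    | algebraMap r => exact ⟨P.algebraMap_mem r, P.algebraMap_mem r⟩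
    | add _ _ _ _ h h' => exact ⟨P.add_mem h.1 h'.1, P.add_mem h.2 h'.2⟩
    | mul _ _ _ _ h h' => exact ⟨P.mul_mem h.1 h'.1, P.mul_mem h.2 h'.2⟩
  induction hF using Algebra.adjoin_induction with
  | mem F hF =>
    rcases hF with ⟨f, hf, rfl⟩ | ⟨f, hf, rfl⟩
    · simpa using (key _ (A.mul_regular f hf)).1
    · simpa using (key _ (A.mul_regular f hf)).2
  | algebraMap r => exact P.algebraMap_mem r
  | add _ _ _ _ h h' => exact P.add_mem h h'
  | mul _ _ _ _ h h' => exact P.mul_mem h h'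

theorem unitsCoord_fg (A : AffineMonoid K M) : A.unitsCoord.FG := by
  let φ : (M → K) →ₐ[K] (Mˣ → K) := AlgHom.pi fun g => Pi.evalAlgHom K (fun _ => K) (g : M)
  let ψ : (M → K) →ₐ[K] (Mˣ → K) :=
    AlgHom.pi fun g => Pi.evalAlgHom K (fun _ => K) ((g⁻¹ : Mˣ) : M)
  have h : A.unitsCoord = A.coord.map φ ⊔ A.coord.map ψ := by
    rw [← Algebra.adjoin_eq (A.coord.map φ), ← Algebra.adjoin_eq (A.coord.map ψ),
      ← Algebra.adjoin_union]
    refine congrArg (Algebra.adjoin K) (congrArg₂ (· ∪ ·) ?_ ?_) <;>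
    · ext F
      constructor
      · rintro ⟨f, hf, rfl⟩
        exact ⟨f, hf, rfl⟩
      · rintro ⟨f, hf, rfl⟩
        exact ⟨f, hf, rfl⟩
  rw [h]
  exact (A.fg.map φ).sup (A.fg.map ψ)

theorem exists_unit_of_algHom (A : AffineMonoid K M) (φ : A.unitsCoord →ₐ[K] K) :
    ∃ g : Mˣ, ∀ F : A.unitsCoord, φ F = (F : Mˣ → K) g := by
  let i₁ : A.coord →ₐ[K] A.unitsCoord :=
    ((AlgHom.pi fun g : Mˣ => Pi.evalAlgHom K (fun _ => K) (g : M)).comp A.coord.val).codRestrict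
      A.unitsCoord fun f => Algebra.subset_adjoin (Or.inl ⟨f, f.2, rfl⟩)
  let i₂ : A.coord →ₐ[K] A.unitsCoord :=
    ((AlgHom.pi fun g : Mˣ => Pi.evalAlgHom K (fun _ => K) ((g⁻¹ : Mˣ) : M)).comp
      A.coord.val).codRestrict
      A.unitsCoord fun f => Algebra.subset_adjoin (Or.inr ⟨f, f.2, rfl⟩)
  obtain ⟨x, hx⟩ := A.eval_surjective (φ.comp i₁)
  obtain ⟨y, hy⟩ := A.eval_surjective (φ.comp i₂)
  have key : ∀ H (hH : H ∈ A.prodCoord A.toAffineVariety),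
      φ ⟨_, A.diag_mem_unitsCoord hH⟩ = H (x, y) := by
    intro H hH
    induction hH using Algebra.adjoin_induction with
    | mem H hH =>
      rcases hH with ⟨f, hf, rfl⟩ | ⟨f, hf, rfl⟩
      · exact hx ⟨f, hf⟩
      · exact hy ⟨f, hf⟩
    | algebraMap r => exact φ.commutes r
    | add u v hu hv h h' =>
      exact (map_add φ ⟨_, A.diag_mem_unitsCoord hu⟩ ⟨_, A.diag_mem_unitsCoord hv⟩).trans
        (congrArg₂ (· + ·) h h')
    | mul u v hu hv h h' =>
      exact (map_mul φ ⟨_, A.diag_mem_unitsCoord hu⟩ ⟨_, A.diag_mem_unitsCoord hv⟩).trans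
        (congrArg₂ (· * ·) h h')
  have swap : ∀ H ∈ A.prodCoord A.toAffineVariety,
      (fun p : M × M => H (p.2, p.1)) ∈ A.prodCoord A.toAffineVariety := by
    intro H hH
    induction hH using Algebra.adjoin_induction with
    | mem H hH =>
      rcases hH with ⟨f, hf, rfl⟩ | ⟨f, hf, rfl⟩
      · exact Algebra.subset_adjoin (Or.inr ⟨f, hf, rfl⟩)
      · exact Algebra.subset_adjoin (Or.inl ⟨f, hf, rfl⟩)
    | algebraMap r => exact (A.prodCoord A.toAffineVariety).algebraMap_mem r
    | add _ _ _ _ h h' => exact (A.prodCoord A.toAffineVariety).add_mem h h'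
    | mul _ _ _ _ h h' => exact (A.prodCoord A.toAffineVariety).mul_mem h h'
  have const : ∀ (c : K) (F : A.unitsCoord), (∀ g, (F : Mˣ → K) g = c) → φ F = c := by
    intro c F hF
    have : F = algebraMap K A.unitsCoord c := Subtype.ext (funext hF)
    rw [this]
    exact φ.commutes c
  have hxy : x * y = 1 := A.eval_injective _ _ fun f hf => by
    rw [← key _ (A.mul_regular f hf)]
    exact const _ _ fun g => by simp
  have hyx : y * x = 1 := A.eval_injective _ _ fun f hf => by
    rw [← key _ (swap _ (A.mul_regular f hf))]
    exact const _ _ fun g => by simp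
  refine ⟨⟨x, y, hxy, hyx⟩, ?_⟩
  rintro ⟨F, hF⟩
  induction hF using Algebra.adjoin_induction with
  | mem F hF =>
    rcases hF with ⟨f, hf, rfl⟩ | ⟨f, hf, rfl⟩
    · exact hx ⟨f, hf⟩
    · exact hy ⟨f, hf⟩
  | algebraMap r => exact φ.commutes r
  | add u v hu hv h h' => exact (map_add φ ⟨u, hu⟩ ⟨v, hv⟩).trans (congrArg₂ (· + ·) h h')
  | mul u v hu hv h h' => exact (map_mul φ ⟨u, hu⟩ ⟨v, hv⟩).trans (congrArg₂ (· * ·) h h')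

/-- The unit group of an affine algebraic monoid, as an affine algebraic group. -/
def units (A : AffineMonoid K M) : AffineGroup K Mˣ where
  coord := A.unitsCoord
  fg := A.unitsCoord_fg
  eval_injective g h hgh := Units.ext <| A.eval_injective _ _ fun f hf =>
    hgh _ (Algebra.subset_adjoin (Or.inl ⟨f, hf, rfl⟩))
  eval_surjective := A.exists_unit_of_algHom
  mul_regular _ hf := A.mul_mem_of_mem_unitsCoord
    (fun F hF => ⟨Algebra.subset_adjoin (Or.inl ⟨F, hF, rfl⟩),
      Algebra.subset_adjoin (Or.inr ⟨F, hF, rfl⟩)⟩) hf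
  inv_regular F hF := by
    induction hF using Algebra.adjoin_induction with
    | mem F hF =>
      rcases hF with ⟨f, hf, rfl⟩ | ⟨f, hf, rfl⟩
      · exact Algebra.subset_adjoin (Or.inr ⟨f, hf, rfl⟩)
      · exact Algebra.subset_adjoin (Or.inl ⟨f, hf, by simp⟩)
    | algebraMap r => exact A.unitsCoord.algebraMap_mem r
    | add _ _ _ _ h h' => exact A.unitsCoord.add_mem h h'
    | mul _ _ _ _ h h' => exact A.unitsCoord.mul_mem h h'

end AffineMonoid

namespace AffineGroup

variable {K : Type*} [Field K] {G : Type*} [Group G]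

/-- Right translation `(ρ_g f)(x) = f (x g)` of functions on `G`. -/
def rightTranslation (K : Type*) [Field K] {G : Type*} [Group G] (g : G) :
    Module.End K (G → K) :=
  LinearMap.funLeft K K (fun x => x * g)

/-- `g` is unipotent: right translation by `g` is a locally unipotent operator on the coordinate
algebra, that is, `ρ_g - 1` is locally nilpotent. -/
def IsUnipotent (A : AffineGroup K G) (g : G) : Prop :=
  ∀ f ∈ A.coord, ∃ n : ℕ, ((rightTranslation K g - 1) ^ n) f = 0

/-- Closed connected subgroups. -/
def IsClosedConnected (A : AffineGroup K G) (H : Subgroup G) : Prop :=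
  IsClosed[A.zariski] (H : Set G) ∧ @IsConnected G A.zariski (H : Set G)

/-- A connected reductive group: `G` is connected and its unipotent radical is trivial, i.e. the
only closed connected normal subgroup consisting of unipotent elements is the trivial one. -/
def IsConnectedReductive (A : AffineGroup K G) : Prop :=
  @IsConnected G A.zariski Set.univ ∧
    ∀ U : Subgroup G, A.IsClosedConnected U → U.Normal → (∀ u ∈ U, A.IsUnipotent u) → U = ⊥

/-- A Borel subgroup: a maximal closed connected solvable subgroup. -/
def IsBorel (A : AffineGroup K G) (B : Subgroup G) : Prop :=
  Maximal (fun H : Subgroup G => A.IsClosedConnected H ∧ Group.IsSolvable H) B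

end AffineGroup

namespace AffineMonoid

variable {K : Type*} [Field K] {M : Type*}

/-- A reductive monoid: an irreducible affine algebraic monoid whose unit group is a connected
reductive group. -/
def IsReductive [Monoid M] (A : AffineMonoid K M) : Prop :=
  @IsIrreducible M A.zariski Set.univ ∧ A.units.IsConnectedReductive

/-- The closure in `M` of a subgroup of the unit group; for a Borel subgroup `B` this is the
Borel submonoid determined by `B`. -/
def closureOf [Monoid M] (A : AffineMonoid K M) (B : Subgroup Mˣ) : Set M :=
  closure[A.zariski] ((fun g : Mˣ => (g : M)) '' (B : Set Mˣ))

/-- The set of nilpotent elements of the closure of `B`. -/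
def nilpotentPart [MonoidWithZero M] (A : AffineMonoid K M) (B : Subgroup Mˣ) : Set M :=
  {x | x ∈ A.closureOf B ∧ ∃ m : ℕ, 0 < m ∧ x ^ m = 0}

/-- An algebraic subsemigroup of `M`: a Zariski-closed subset that is stable under
multiplication. -/
def IsAlgebraicSubsemigroup [Monoid M] (A : AffineMonoid K M) (S : Set M) : Prop :=
  IsClosed[A.zariski] S ∧ ∀ x ∈ S, ∀ y ∈ S, x * y ∈ S

/-- Stability under the action `(b₁, b₂) · x = b₁ x b₂⁻¹` of `B × B` on `M`. -/
def IsBiStable [Monoid M] (B : Subgroup Mˣ) (S : Set M) : Prop :=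
  ∀ b₁ ∈ B, ∀ b₂ ∈ B, ∀ x ∈ S, (b₁ : M) * x * ((b₂⁻¹ : Mˣ) : M) ∈ S

end AffineMonoid

/-! Let `M` act by right translation on the span `V` of the functions `x ↦ s (x * m) - s 0`, with
`s` running through generators of the coordinate algebra. This `V` is finite-dimensional, its matrix
coefficients are regular, and only `0` acts as zero, so `x` is nilpotent iff its operator is
(`exists_representation`).

By Lie–Kolchin (`Subgroup.hasCommonEigenvectors_of_isSolvable`) the group `B` acts by triangular
matrices. Triangularity is a closed condition, so it persists on the closure of `B`. The diagonal
entries are regular functions, multiplicative on that closure, and a triangular matrix is nilpotent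
iff its diagonal vanishes. The nilpotent part is therefore the common zero set of these functions in
the closure: it is closed, and it is a two-sided ideal because the functions are multiplicative.

The Zariski topology does not make the group a topological group, so the topological arguments use
only continuity in one variable and closed fibres of regular functions. -/

open scoped commutatorElement

/-! ### The Lie–Kolchin theorem under separate continuity -/

section LieKolchin

/-- A function with finitely many values and closed fibres on a preconnected space is constant. -/
theorem eq_of_finite_range_of_isClosed_fibres {X Y : Type*} [TopologicalSpace X]
    [PreconnectedSpace X] {f : X → Y} (hfin : (Set.range f).Finite)
    (hcl : ∀ c, IsClosed {x | f x = c}) (x y : X) : f x = f y := by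
  have hopen : IsOpen {z | f z = f x} := by
    have : {z | f z = f x}ᶜ = ⋃ c ∈ Set.range f \ {f x}, {z | f z = c} := by
      ext z
      simp
    rw [← isClosed_compl_iff, this]
    exact (hfin.subset Set.sdiff_subset).isClosed_biUnion fun c _ => hcl c
  have huniv : {z | f z = f x} = Set.univ :=
    IsClopen.eq_univ ⟨hcl _, hopen⟩ ⟨x, rfl⟩
  have : y ∈ {z | f z = f x} := huniv ▸ Set.mem_univ y
  exact this.symm

variable {Γ : Type*} [Group Γ] [TopologicalSpace Γ]

/-- A product of commutators is joined to `1` by a chain of translates `x * ⁅g, H⁆`. Each is a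
continuous image of `H` and contains `x`, as `⁅g, 1⁆ = 1`. -/
theorem Subgroup.isPreconnected_commutator (hmul : ∀ g : Γ, Continuous fun x => g * x)
    (hcomm : ∀ g : Γ, Continuous fun x : Γ => ⁅g, x⁆) {H : Subgroup Γ}
    (hH : IsPreconnected (H : Set Γ)) : IsPreconnected ((⁅H, H⁆ : Subgroup Γ) : Set Γ) := by
  have key : ∀ h ∈ (⁅H, H⁆ : Subgroup Γ), ∃ T : Set Γ, T ⊆ ((⁅H, H⁆ : Subgroup Γ) : Set Γ) ∧
      1 ∈ T ∧ h ∈ T ∧ IsPreconnected T := by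
    intro h hh
    rw [Subgroup.commutator_def] at hh
    induction hh using Subgroup.closure_induction_right with
    | one => exact ⟨{1}, by simp [one_mem], rfl, rfl, isPreconnected_singleton⟩
    | mul_right x hx y hy ih =>
      obtain ⟨T, hT, h1, hxT, hpre⟩ := ih
      obtain ⟨g, hg, k, hk, rfl⟩ := hy
      refine ⟨T ∪ (fun z => x * ⁅g, z⁆) '' H, ?_, Or.inl h1, Or.inr ⟨k, hk, rfl⟩, ?_⟩
      · refine Set.union_subset hT ?_
        rintro _ ⟨z, hz, rfl⟩
        exact mul_mem (hT hxT) (Subgroup.commutator_mem_commutator hg hz)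
      · exact hpre.union x hxT ⟨1, H.one_mem, by simp⟩
          (hH.image _ ((hmul x).comp (hcomm g)).continuousOn)
    | mul_inv_cancel x hx y hy ih =>
      obtain ⟨T, hT, h1, hxT, hpre⟩ := ih
      obtain ⟨g, hg, k, hk, rfl⟩ := hy
      -- Since `⁅g, k⁆⁻¹ = ⁅k, g⁆`, the two entries exchange roles.
      refine ⟨T ∪ (fun z => x * ⁅k, z⁆) '' H, ?_, Or.inl h1,
        Or.inr ⟨g, hg, by simp⟩, ?_⟩
      · refine Set.union_subset hT ?_
        rintro _ ⟨z, hz, rfl⟩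
        exact mul_mem (hT hxT) (Subgroup.commutator_mem_commutator hk hz)
      · exact hpre.union x hxT ⟨1, H.one_mem, by simp⟩
          (hH.image _ ((hmul x).comp (hcomm k)).continuousOn)
  refine isPreconnected_of_forall 1 fun h hh => ?_
  obtain ⟨T, hT, h1, hhT, hpre⟩ := key h hh
  exact ⟨T, hT, h1, hhT, hpre⟩

/-- The matrix coefficients of `ρ` have closed fibres. -/
def HasClosedCoefficients {K : Type*} [Field K] {V : Type*} [AddCommGroup V] [Module K V]
    {X : Type*} [TopologicalSpace X] (ρ : X → Module.End K V) : Prop :=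
  ∀ (v : V) (l : Module.Dual K V) (c : K), IsClosed {g | l (ρ g v) = c}

/-- Every nonzero finite-dimensional representation of `H` whose coefficients have closed fibres
has a common eigenvector. -/
def Subgroup.HasCommonEigenvectors.{u, v, w} (K : Type u) [Field K] {Γ : Type v} [Group Γ]
    [TopologicalSpace Γ] (H : Subgroup Γ) : Prop :=
  ∀ (V : Type w) [AddCommGroup V] [Module K V] [FiniteDimensional K V] [Nontrivial V]
    (ρ : H →* Module.End K V), HasClosedCoefficients ρ →
    ∃ v : V, v ≠ 0 ∧ ∀ g, ∃ c : K, ρ g v = c • v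

section Irreducible

variable {K : Type*} [Field K] {V : Type*} [AddCommGroup V] [Module K V]
  [FiniteDimensional K V] {H : Subgroup Γ} {ρ : H →* Module.End K V}

/-- A normal subgroup with a common eigenvector acts by scalars on an irreducible representation
of a connected group. -/
theorem exists_eq_smul_of_irreducible [PreconnectedSpace H]
    (hconj : ∀ h : Γ, Continuous fun x : Γ => x⁻¹ * h * x) (hρ : HasClosedCoefficients ρ)
    (hirr : ∀ W : Submodule K V, (∀ g, ∀ w ∈ W, ρ g w ∈ W) → W ≠ ⊥ → W = ⊤)
    {N : Subgroup H} (hN : N.Normal) {v : V} (hv : v ≠ 0)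
    (heig : ∀ h ∈ N, ∃ c : K, ρ h v = c • v) {h : H} (hh : h ∈ N) :
    ∃ c : K, ∀ w, ρ h w = c • w := by
  -- Dividing by `l v` writes the eigenvalue on `v` as a matrix coefficient, which has closed
  -- fibres.
  obtain ⟨l, hl⟩ := Module.Projective.exists_dual_ne_zero K hv
  have hchar : ∀ k ∈ N, ρ k v = (l (ρ k v) / l v) • v := by
    intro k hk
    obtain ⟨c, hc⟩ := heig k hk
    rw [hc, map_smul, smul_eq_mul, mul_div_cancel_right₀ _ hl]
  have hcont : Continuous fun g : H => g⁻¹ * h * g :=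
    Continuous.subtype_mk ((hconj h).comp continuous_subtype_val) _
  have hmove : ∀ g : H, ρ h (ρ g v) = (l (ρ (g⁻¹ * h * g) v) / l v) • ρ g v := by
    intro g
    have hk : g⁻¹ * h * g ∈ N := by simpa using hN.conj_mem h hh g⁻¹
    rw [← map_smul, ← hchar _ hk, ← Module.End.mul_apply, ← Module.End.mul_apply, ← map_mul,
      ← map_mul]
    congr 2
    group
  have hne : ∀ g : H, ρ g v ≠ 0 := by
    intro g hg
    apply hv
    have : ρ g⁻¹ (ρ g v) = v := by
      rw [← Module.End.mul_apply, ← map_mul]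
      simp
    rw [← this, hg, map_zero]
  -- By `hmove` these values are eigenvalues of the single operator `ρ h`, hence finitely many, and
  -- connectedness forces them to coincide.
  have hconst : ∀ g : H, l (ρ (g⁻¹ * h * g) v) / l v = l (ρ h v) / l v := by
    intro g
    have := eq_of_finite_range_of_isClosed_fibres (f := fun g : H => l (ρ (g⁻¹ * h * g) v) / l v)
      ?_ ?_ g 1
    · simpa using this
    · refine (Module.End.finite_hasEigenvalue (ρ h)).subset ?_
      rintro _ ⟨g, rfl⟩
      exact Module.End.hasEigenvalue_of_hasEigenvector
        ⟨Module.End.mem_eigenspace_iff.2 (hmove g), hne g⟩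
    · intro c
      have : {g : H | l (ρ (g⁻¹ * h * g) v) / l v = c} =
          (fun g : H => g⁻¹ * h * g) ⁻¹' {k | l (ρ k v) = c * l v} := by
        ext g
        simp [div_eq_iff hl]
      rw [this]
      exact (hρ v l _).preimage hcont
  refine ⟨l (ρ h v) / l v, ?_⟩
  -- `ρ h` acts by one scalar on the orbit of `v`, and the orbit spans `V` by irreducibility.
  have htop := hirr (Submodule.span K (Set.range fun g => ρ g v)) ?_ ?_
  · intro w
    have hw : w ∈ Submodule.span K (Set.range fun g => ρ g v) := htop ▸ Submodule.mem_top
    induction hw using Submodule.span_induction with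
    | mem x hx =>
      obtain ⟨g, rfl⟩ := hx
      simp only [hmove, hconst]
    | zero => simp
    | add x y _ _ hx hy => rw [map_add, hx, hy, smul_add]
    | smul a x _ hx => rw [map_smul, hx, smul_comm]
  · intro g w hw
    induction hw using Submodule.span_induction with
    | mem x hx =>
      obtain ⟨k, rfl⟩ := hx
      exact Submodule.subset_span ⟨g * k, by simp [map_mul]⟩
    | zero => simp
    | add x y _ _ hx hy => rw [map_add]; exact add_mem hx hy
    | smul a x _ hx => rw [map_smul]; exact Submodule.smul_mem _ _ hx
  · intro hbot
    have : v ∈ Submodule.span K (Set.range fun g => ρ g v) :=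
      Submodule.subset_span ⟨1, by simp⟩
    rw [hbot] at this
    exact hv this

/-- If the commutators act by scalars on a nonzero representation of a connected group, then the
group acts commutatively. -/
theorem commute_of_commutator_eq_smul [PreconnectedSpace H] [Nontrivial V]
    (hcomm : ∀ g : Γ, Continuous fun x : Γ => ⁅g, x⁆) (hρ : HasClosedCoefficients ρ)
    (hscal : ∀ g x : H, ∃ c : K, ∀ w, ρ ⁅g, x⁆ w = c • w) (g x : H) :
    ρ g * ρ x = ρ x * ρ g := by
  obtain ⟨v, hv⟩ := exists_ne (0 : V)
  obtain ⟨l, hl⟩ := Module.Projective.exists_dual_ne_zero K hv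
  have hval : ∀ (y : H) (w : V), ρ ⁅g, y⁆ w = (l (ρ ⁅g, y⁆ v) / l v) • w := by
    intro y w
    obtain ⟨c, hc⟩ := hscal g y
    rw [hc, hc, map_smul, smul_eq_mul, mul_div_cancel_right₀ _ hl]
  -- A commutator has determinant `1`, so its scalar is a root of unity of order dividing `dim V`.
  -- There are finitely many of these, and connectedness lets the scalar be computed at `y = 1`.
  have hroot : ∀ y : H, (l (ρ ⁅g, y⁆ v) / l v) ^ Module.finrank K V = 1 := by
    intro y
    have h1 : LinearMap.det (ρ ⁅g, y⁆) = 1 := by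
      change ((LinearMap.det : Module.End K V →* K).comp ρ) ⁅g, y⁆ = 1
      have hone : ∀ k : H, ((LinearMap.det : Module.End K V →* K).comp ρ) k *
          ((LinearMap.det : Module.End K V →* K).comp ρ) k⁻¹ = 1 := fun k => by
        rw [← map_mul, mul_inv_cancel, map_one]
      rw [commutatorElement_def, map_mul, map_mul, map_mul, mul_right_comm _ _
        (((LinearMap.det : Module.End K V →* K).comp ρ) g⁻¹), hone, one_mul, hone]
    have h2 : ρ ⁅g, y⁆ = (l (ρ ⁅g, y⁆ v) / l v) • (1 : Module.End K V) := by
      ext w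
      exact hval y w
    rw [h2, LinearMap.det_smul] at h1
    simpa using h1
  have hcont : Continuous fun y : H => ⁅g, y⁆ :=
    Continuous.subtype_mk ((hcomm g).comp continuous_subtype_val) _
  have hconst := eq_of_finite_range_of_isClosed_fibres
    (f := fun y : H => l (ρ ⁅g, y⁆ v) / l v) ?_ ?_ x 1
  · have hone : ρ ⁅g, x⁆ = 1 := by
      ext w
      rw [hval x w]
      rw [hconst]
      simp [div_self hl]
    have : ⁅g, x⁆ * (x * g) = g * x := by
      rw [commutatorElement_def]
      group
    rw [← map_mul, ← this, map_mul, hone, one_mul, map_mul]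
  · refine (Polynomial.finite_setOfPred_isRoot
      (p := (Polynomial.X ^ Module.finrank K V - 1 : Polynomial K)) ?_).subset ?_
    · exact Polynomial.X_pow_sub_C_ne_zero Module.finrank_pos 1
    · rintro _ ⟨y, rfl⟩
      simp [Polynomial.IsRoot, hroot y]
  · intro c
    have : {y : H | l (ρ ⁅g, y⁆ v) / l v = c} =
        (fun y : H => ⁅g, y⁆) ⁻¹' {k | l (ρ k v) = c * l v} := by
      ext y
      simp [div_eq_iff hl]
    rw [this]
    exact (hρ v l _).preimage hcont

end Irreducible

/-- The restriction of a representation to a stable subspace. -/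
def restrictStable {K : Type*} [Field K] {V : Type*} [AddCommGroup V] [Module K V] {N : Type*}
    [Monoid N] (ρ : N →* Module.End K V) (W : Submodule K V) (hW : ∀ g, ∀ w ∈ W, ρ g w ∈ W) :
    N →* Module.End K W where
  toFun g := (ρ g).restrict (hW g)
  map_one' := by
    ext w
    simp
  map_mul' g h := by
    ext w
    simp

/-- Induction on `dim V` reduces to the irreducible case. There the commutator subgroup has a common
eigenvector, hence acts by scalars, hence `H` acts commutatively. An eigenspace of any `ρ g` is then
stable, so it is all of `V` and every element acts by a scalar. -/
theorem Subgroup.HasCommonEigenvectors.of_commutator.{u, v, w} {K : Type u} [Field K]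
    [IsAlgClosed K] {Γ : Type v} [Group Γ] [TopologicalSpace Γ]
    (hcomm : ∀ g : Γ, Continuous fun x : Γ => ⁅g, x⁆)
    (hconj : ∀ h : Γ, Continuous fun x : Γ => x⁻¹ * h * x) {H : Subgroup Γ}
    (hH : IsPreconnected (H : Set Γ))
    (hder : Subgroup.HasCommonEigenvectors.{u, v, w} K ⁅H, H⁆) :
    Subgroup.HasCommonEigenvectors.{u, v, w} K H := by
  have : PreconnectedSpace H := isPreconnected_iff_preconnectedSpace.1 hH
  intro V _ _ _ _ ρ hρ
  induction hn : Module.finrank K V using Nat.strong_induction_on generalizing V with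
  | _ n ih =>
  by_cases hred : ∃ W : Submodule K V, (∀ g, ∀ w ∈ W, ρ g w ∈ W) ∧ W ≠ ⊥ ∧ W ≠ ⊤
  · obtain ⟨W, hW, hbot, htop⟩ := hred
    have : Nontrivial W := Submodule.nontrivial_iff_ne_bot.2 hbot
    obtain ⟨w, hw, heig⟩ := ih _ (hn ▸ Submodule.finrank_lt htop) W
      (restrictStable ρ W hW) (by
        intro w l c
        obtain ⟨l', hl'⟩ := LinearMap.exists_extend l
        have := hρ w l' c
        convert this using 3 with g
        rw [← hl']
        rfl) rfl
    refine ⟨w, fun h => hw (Subtype.ext h), fun g => ?_⟩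
    obtain ⟨c, hc⟩ := heig g
    exact ⟨c, congrArg Subtype.val hc⟩
  · have hirr : ∀ W : Submodule K V, (∀ g, ∀ w ∈ W, ρ g w ∈ W) → W ≠ ⊥ → W = ⊤ :=
      fun W hW hbot => by_contra fun htop => hred ⟨W, hW, hbot, htop⟩
    have hle : ⁅H, H⁆ ≤ H := Subgroup.commutator_le_self H
    obtain ⟨v, hv, heig⟩ := hder V (ρ.comp (Subgroup.inclusion hle))
      (fun v l c => (hρ v l c).preimage
        (Continuous.subtype_mk continuous_subtype_val _ : Continuous (Subgroup.inclusion hle)))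
    have hscal : ∀ g x : H, ∃ c : K, ∀ w, ρ ⁅g, x⁆ w = c • w := fun g x =>
      exists_eq_smul_of_irreducible hconj hρ hirr (N := _root_.commutator H) inferInstance hv
        (fun h hh => by
          have hmem : (h : Γ) ∈ (⁅H, H⁆ : Subgroup Γ) := by
            rw [← Subgroup.map_subtype_commutator]
            exact ⟨h, hh, rfl⟩
          exact heig ⟨h, hmem⟩)
        (Subgroup.commutator_mem_commutator (Subgroup.mem_top g) (Subgroup.mem_top x))
    have hab := commute_of_commutator_eq_smul hcomm hρ hscal
    refine ⟨v, hv, fun g => ?_⟩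
    obtain ⟨c, hc⟩ := Module.End.exists_eigenvalue (ρ g)
    have htop := hirr (Module.End.eigenspace (ρ g) c) (fun x w hw => by
      rw [Module.End.mem_eigenspace_iff] at hw ⊢
      rw [← Module.End.mul_apply, hab, Module.End.mul_apply, hw, map_smul]) hc
    exact ⟨c, Module.End.mem_eigenspace_iff.1 (htop ▸ Submodule.mem_top)⟩

/-- Lie–Kolchin: a connected solvable group has a common eigenvector in every nonzero
finite-dimensional representation. -/
theorem Subgroup.hasCommonEigenvectors_of_isSolvable.{u, v, w} {K : Type u} [Field K]
    [IsAlgClosed K] {Γ : Type v} [Group Γ] [TopologicalSpace Γ]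
    (hmul : ∀ g : Γ, Continuous fun x => g * x)
    (hcomm : ∀ g : Γ, Continuous fun x : Γ => ⁅g, x⁆)
    (hconj : ∀ h : Γ, Continuous fun x : Γ => x⁻¹ * h * x) {H : Subgroup Γ}
    (hH : IsPreconnected (H : Set Γ)) (hsol : Group.IsSolvable H) :
    Subgroup.HasCommonEigenvectors.{u, v, w} K H := by
  obtain ⟨n, hn⟩ := hsol.solvable
  -- The derived series is pushed into `Γ`, so that the series of `H` and of `⁅H, H⁆` can be
  -- compared as subgroups of one group.
  have key : ∀ n (H : Subgroup Γ), IsPreconnected (H : Set Γ) →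
      (derivedSeries H n).map H.subtype = ⊥ → Subgroup.HasCommonEigenvectors.{u, v, w} K H := by
    intro n
    induction n with
    | zero =>
      intro H _ hbot V _ _ _ _ ρ _
      obtain ⟨v, hv⟩ := exists_ne (0 : V)
      refine ⟨v, hv, fun g => ⟨1, ?_⟩⟩
      have hg : (g : Γ) ∈ (derivedSeries H 0).map H.subtype := ⟨g, by simp, rfl⟩
      rw [hbot, Subgroup.mem_bot] at hg
      have : g = 1 := Subtype.ext hg
      simp [this]
    | succ n ih =>
      intro H hH hbot
      refine .of_commutator hcomm hconj hH (ih _ (isPreconnected_commutator hmul hcomm hH) ?_)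
      rw [← hbot]
      have : ∀ k, (derivedSeries (⁅H, H⁆ : Subgroup Γ) k).map (Subgroup.subtype _) =
          (derivedSeries H (k + 1)).map H.subtype := by
        intro k
        induction k with
        | zero =>
          rw [derivedSeries_zero, derivedSeries_one, Subgroup.map_subtype_commutator,
            ← MonoidHom.range_eq_map, Subgroup.range_subtype]
        | succ k ihk =>
          rw [derivedSeries_succ, derivedSeries_succ, Subgroup.map_commutator,
            Subgroup.map_commutator, ihk]
      exact this n
  exact key n H hH (by rw [hn, Subgroup.map_bot])

end LieKolchin

/-! ### Regular functions, slices and closures of subgroups -/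

section Regular

namespace AffineVariety

variable {K : Type*} [Field K] {X Y : Type*}

theorem isClosed_iff_exists_zeros (A : AffineVariety K X) {S : Set X} :
    IsClosed[A.zariski] S ↔ ∃ F : Set (X → K), F ⊆ A.coord ∧ S = zeros F := by
  let _ := A.zariski
  rw [← isOpen_compl_iff]
  change Sᶜᶜ ∈ {S | ∃ F : Set (X → K), F ⊆ A.coord ∧ S = zeros F} ↔ _
  rw [compl_compl]
  rfl

theorem isClosed_zeros (A : AffineVariety K X) {F : Set (X → K)} (hF : F ⊆ A.coord) :
    IsClosed[A.zariski] (zeros F) :=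
  A.isClosed_iff_exists_zeros.2 ⟨F, hF, rfl⟩

theorem isClosed_fibre (A : AffineVariety K X) {f : X → K} (hf : f ∈ A.coord) (c : K) :
    IsClosed[A.zariski] {x | f x = c} := by
  have : {x | f x = c} = zeros {f - algebraMap K (X → K) c} := by
    ext x
    simp [zeros, sub_eq_zero]
  rw [this]
  exact A.isClosed_zeros (Set.singleton_subset_iff.2
    (A.coord.sub_mem hf (A.coord.algebraMap_mem c)))

theorem eq_zero_of_mem_closure (A : AffineVariety K X) {f : X → K} (hf : f ∈ A.coord)
    {S : Set X} (hS : ∀ x ∈ S, f x = 0) {x : X} (hx : x ∈ closure[A.zariski] S) : f x = 0 := by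
  let _ := A.zariski
  exact closure_minimal hS (A.isClosed_fibre hf 0) hx

theorem continuous_of_comp_mem (A : AffineVariety K X) (A' : AffineVariety K Y) {φ : X → Y}
    (hφ : ∀ f ∈ A'.coord, f ∘ φ ∈ A.coord) : @Continuous X Y A.zariski A'.zariski φ := by
  let _ := A.zariski
  let _ := A'.zariski
  refine continuous_iff_isClosed.2 fun S hS => ?_
  obtain ⟨F, hF, rfl⟩ := A'.isClosed_iff_exists_zeros.1 hS
  have : φ ⁻¹' zeros F = zeros ((fun f => f ∘ φ) '' F) := by
    ext x
    simp [zeros]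
  rw [this]
  refine A.isClosed_zeros ?_
  rintro _ ⟨f, hf, rfl⟩
  exact hφ f (hF hf)

/-- Regular functions on a product are sums of products of regular functions. -/
theorem prodCoord_le_span (A : AffineVariety K X) (A' : AffineVariety K Y) {F : X × Y → K}
    (hF : F ∈ A.prodCoord A') :
    F ∈ Submodule.span K {F | ∃ f ∈ A.coord, ∃ f' ∈ A'.coord, F = fun p => f p.1 * f' p.2} := by
  rw [prodCoord, ← Subalgebra.mem_toSubmodule, Algebra.adjoin_eq_span] at hF
  refine Submodule.span_mono ?_ hF
  intro F hF
  induction hF using Submonoid.closure_induction with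
  | mem F hF =>
    rcases hF with ⟨f, hf, rfl⟩ | ⟨f, hf, rfl⟩
    · exact ⟨f, hf, 1, A'.coord.one_mem, by simp⟩
    · exact ⟨1, A.coord.one_mem, f, hf, by simp⟩
  | one => exact ⟨1, A.coord.one_mem, 1, A'.coord.one_mem, by ext; simp⟩
  | mul _ _ _ _ h h' =>
    obtain ⟨f, hf, g, hg, rfl⟩ := h
    obtain ⟨f', hf', g', hg', rfl⟩ := h'
    refine ⟨f * f', A.coord.mul_mem hf hf', g * g', A'.coord.mul_mem hg hg', ?_⟩
    ext p
    simp only [Pi.mul_apply]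
    ring

/-- The slices of a regular function on a product span a finite-dimensional space of regular
functions. -/
theorem exists_slices_mem (A : AffineVariety K X) (A' : AffineVariety K Y) {F : X × Y → K}
    (hF : F ∈ A.prodCoord A') : ∃ W : Submodule K (X → K), FiniteDimensional K W ∧
      W ≤ Subalgebra.toSubmodule A.coord ∧ ∀ y, (fun x => F (x, y)) ∈ W := by
  replace hF := A.prodCoord_le_span A' hF
  induction hF using Submodule.span_induction with
  | mem F hF =>
    obtain ⟨f, hf, g, -, rfl⟩ := hF
    refine ⟨Submodule.span K {f}, inferInstance, ?_, fun y => ?_⟩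
    · exact (Submodule.span_singleton_le_iff_mem f _).2 hf
    · refine Submodule.mem_span_singleton.2 ⟨g y, ?_⟩
      ext x
      simp [mul_comm]
  | zero => exact ⟨⊥, inferInstance, bot_le, fun y => rfl⟩
  | add F F' _ _ h h' =>
    obtain ⟨W, hW, hle, hmem⟩ := h
    obtain ⟨W', hW', hle', hmem'⟩ := h'
    exact ⟨W ⊔ W', inferInstance, sup_le hle hle', fun y =>
      add_mem (Submodule.mem_sup_left (hmem y)) (Submodule.mem_sup_right (hmem' y))⟩
  | smul a F _ h =>
    obtain ⟨W, hW, hle, hmem⟩ := h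
    exact ⟨W, hW, hle, fun y => W.smul_mem a (hmem y)⟩

/-- This makes matrix coefficients of translation representations regular: on a product `f ⊗ g` the
functional `l` yields `l f • g`. -/
theorem dual_slice_mem (A : AffineVariety K X) (A' : AffineVariety K Y) {F : X × Y → K}
    (hF : F ∈ A.prodCoord A') (l : Module.Dual K (X → K)) :
    (fun y => l fun x => F (x, y)) ∈ A'.coord := by
  replace hF := A.prodCoord_le_span A' hF
  induction hF using Submodule.span_induction with
  | mem F hF =>
    obtain ⟨f, hf, g, hg, rfl⟩ := hF
    have : (fun y => l fun x => f x * g y) = l f • g := by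
      ext y
      have h : (fun x => f x * g y) = g y • f := by
        ext x
        simp [mul_comm]
      rw [h, map_smul]
      simp [mul_comm]
    rw [this]
    exact A'.coord.smul_mem hg _
  | zero =>
    convert A'.coord.zero_mem using 1
    ext y
    exact map_zero l
  | add F F' _ _ h h' =>
    convert A'.coord.add_mem h h' using 1
    ext y
    exact map_add l _ _
  | smul a F _ h =>
    convert A'.coord.smul_mem h a using 1
    ext y
    exact map_smul l a _

end AffineVariety

namespace AffineMonoid

variable {K : Type*} [Field K] {M : Type*} [Monoid M]

/-- Pointwise products of regular maps are regular. -/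
theorem mul_comp_mem (A : AffineMonoid K M) {X : Type*} {P : Subalgebra K (X → K)} {φ ψ : X → M}
    (hφ : ∀ f ∈ A.coord, (fun x => f (φ x)) ∈ P) (hψ : ∀ f ∈ A.coord, (fun x => f (ψ x)) ∈ P)
    {f : M → K} (hf : f ∈ A.coord) : (fun x => f (φ x * ψ x)) ∈ P := by
  have key : ∀ H ∈ A.prodCoord A.toAffineVariety, (fun x => H (φ x, ψ x)) ∈ P := by
    intro H hH
    induction hH using Algebra.adjoin_induction with
    | mem H hH =>
      rcases hH with ⟨f, hf, rfl⟩ | ⟨f, hf, rfl⟩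
      · exact hφ f hf
      · exact hψ f hf
    | algebraMap r => exact P.algebraMap_mem r
    | add _ _ _ _ h h' => exact P.add_mem h h'
    | mul _ _ _ _ h h' => exact P.mul_mem h h'
  exact key _ (A.mul_regular f hf)

theorem mul_left_mem (A : AffineMonoid K M) (a : M) {f : M → K} (hf : f ∈ A.coord) :
    (fun x => f (a * x)) ∈ A.coord :=
  A.mul_comp_mem (φ := fun _ => a) (ψ := id)
    (fun f _ => A.coord.algebraMap_mem (f a)) (fun _ hf => hf) hf

theorem mul_right_mem (A : AffineMonoid K M) (a : M) {f : M → K} (hf : f ∈ A.coord) :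
    (fun x => f (x * a)) ∈ A.coord :=
  A.mul_comp_mem (φ := id) (ψ := fun _ => a)
    (fun _ hf => hf) (fun f _ => A.coord.algebraMap_mem (f a)) hf

/-- The closure of a subgroup of the unit group is a submonoid. -/
def closureSubmonoid (A : AffineMonoid K M) (B : Subgroup Mˣ) : Submonoid M where
  carrier := A.closureOf B
  one_mem' := by
    let _ := A.zariski
    exact subset_closure ⟨1, B.one_mem, rfl⟩
  mul_mem' := by
    let _ := A.zariski
    have hl : ∀ a : M, Continuous fun x => a * x := fun a =>
      A.continuous_of_comp_mem _ fun f hf => A.mul_left_mem a hf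
    have hr : ∀ a : M, Continuous fun x => x * a := fun a =>
      A.continuous_of_comp_mem _ fun f hf => A.mul_right_mem a hf
    intro x y hx hy
    -- The closure is taken in one factor at a time: left translations by `B` first, then right
    -- translation by a point of the closure.
    have hB : ∀ b ∈ B, ∀ z ∈ A.closureOf B, (b : M) * z ∈ A.closureOf B := by
      intro b hb z hz
      refine map_mem_closure (hl b) hz ?_
      rintro _ ⟨c, hc, rfl⟩
      exact ⟨b * c, B.mul_mem hb hc, by simp⟩
    have := map_mem_closure (hr y) hx (t := A.closureOf B) (by
      rintro _ ⟨b, hb, rfl⟩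
      exact hB b hb y hy)
    rwa [closureOf, closure_closure] at this

/-- The inclusion of a subgroup of the unit group into its closure. -/
def toClosure (A : AffineMonoid K M) (B : Subgroup Mˣ) : B →* A.closureSubmonoid B where
  toFun b := ⟨((b : Mˣ) : M), by
    let _ := A.zariski
    exact subset_closure ⟨b, b.2, rfl⟩⟩
  map_one' := rfl
  map_mul' _ _ := rfl

end AffineMonoid

/-- The maps required to be continuous have one argument fixed, so they are regular in the other and
Zariski continuous. -/
theorem AffineGroup.hasCommonEigenvectors.{u, v, w} {K : Type u} [Field K] [IsAlgClosed K]
    {G : Type v} [Group G] (A : AffineGroup K G) {B : Subgroup G}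
    (hB : @IsPreconnected G A.zariski (B : Set G)) (hsol : Group.IsSolvable B) :
    @Subgroup.HasCommonEigenvectors.{u, v, w} K _ G _ A.zariski B := by
  let _ := A.zariski
  have hconst : ∀ g : G, ∀ f ∈ A.coord, (fun _ : G => f g) ∈ A.coord :=
    fun g f _ => A.coord.algebraMap_mem (f g)
  refine Subgroup.hasCommonEigenvectors_of_isSolvable ?_ ?_ ?_ hB hsol
  · exact fun g => A.continuous_of_comp_mem _ fun f hf => A.mul_left_mem g hf
  · refine fun g => A.continuous_of_comp_mem _ fun f hf => ?_
    refine A.mul_comp_mem (φ := fun x => g * x * g⁻¹) (ψ := fun x => x⁻¹) (fun f hf => ?_)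
      A.inv_regular hf
    exact A.mul_left_mem g (A.mul_right_mem g⁻¹ hf)
  · refine fun h => A.continuous_of_comp_mem _ fun f hf => ?_
    refine A.mul_comp_mem (φ := fun x => x⁻¹ * h) (ψ := fun x => x) (fun f hf => ?_)
      (fun _ hf => hf) hf
    exact A.inv_regular _ (A.mul_right_mem h hf)

end Regular

/-! ### Nilpotency modulo an eigenvector -/

section Quotient

variable {K : Type*} [Field K] {V : Type*} [AddCommGroup V] [Module K V]

/-- The representation on the quotient by a stable subspace. -/
def quotientStable {N : Type*} [Monoid N] (ρ : N →* Module.End K V) (W : Submodule K V)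
    (hW : ∀ g, W ≤ W.comap (ρ g)) : N →* Module.End K (V ⧸ W) where
  toFun g := W.mapQ W (ρ g) (hW g)
  map_one' := by
    ext w
    simp
  map_mul' g h := by
    ext w
    simp

/-- An operator is nilpotent iff it is nilpotent modulo the line spanned by an eigenvector and
the eigenvalue vanishes. -/
theorem isNilpotent_iff_mapQ_span_singleton {T : Module.End K V} {v : V} (hv : v ≠ 0) {c : K}
    (hc : T v = c • v) (hle : K ∙ v ≤ (K ∙ v).comap T) :
    IsNilpotent T ↔ c = 0 ∧ IsNilpotent ((K ∙ v).mapQ (K ∙ v) T hle) := by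
  constructor
  · rintro ⟨n, hn⟩
    refine ⟨?_, n, ?_⟩
    · have hpow : ∀ k : ℕ, (T ^ k) v = c ^ k • v := by
        intro k
        induction k with
        | zero => simp
        | succ k ih => rw [pow_succ', Module.End.mul_apply, ih, map_smul, hc, smul_smul, pow_succ]
      have h := hpow n
      rw [hn, LinearMap.zero_apply] at h
      exact eq_zero_of_pow_eq_zero ((smul_eq_zero.1 h.symm).resolve_right hv)
    · rw [← Submodule.mapQ_pow]
      ext w
      simp [hn]
  · rintro ⟨rfl, n, hn⟩
    -- `T ^ n` maps into the line of `v`, which one further `T` kills since the eigenvalue is zero.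
    refine ⟨n + 1, ?_⟩
    ext w
    rw [← Submodule.mapQ_pow] at hn
    have h : (K ∙ v).mkQ ((T ^ n) w) = 0 := LinearMap.congr_fun hn ((K ∙ v).mkQ w)
    rw [Submodule.mkQ_apply, Submodule.Quotient.mk_eq_zero, Submodule.mem_span_singleton] at h
    obtain ⟨a, ha⟩ := h
    rw [pow_succ', Module.End.mul_apply, ← ha, map_smul, hc]
    simp

end Quotient

/-! ### Diagonal characters and the nilpotent part -/

namespace AffineMonoid

/-- In a representation of the closure of a connected solvable subgroup `B`, nilpotency is the
vanishing of regular functions that are multiplicative on the closure of `B`. -/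
theorem exists_multiplicative_of_representation.{u, v, w} {K : Type u} [Field K] [IsAlgClosed K]
    {M : Type v} [Monoid M] (A : AffineMonoid K M) {B : Subgroup Mˣ}
    (hB : @Subgroup.HasCommonEigenvectors.{u, v, w} K _ Mˣ _ A.units.zariski B)
    (V : Type w) [AddCommGroup V] [Module K V] [FiniteDimensional K V]
    (ρ : A.closureSubmonoid B →* Module.End K V)
    (hρ : ∀ (v : V) (l : Module.Dual K V), ∃ f ∈ A.coord, ∀ x, l (ρ x v) = f x) :
    ∃ T : Set (M → K), T ⊆ A.coord ∧
      (∀ χ ∈ T, ∀ x y : A.closureSubmonoid B, χ (x * y) = χ x * χ y) ∧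
      ∀ x, IsNilpotent (ρ x) ↔ ∀ χ ∈ T, χ x = 0 := by
  induction hn : Module.finrank K V using Nat.strong_induction_on generalizing V with
  | _ n ih =>
  cases subsingleton_or_nontrivial V with
  | inl h =>
    refine ⟨∅, Set.empty_subset _, by simp, fun x => ?_⟩
    have : ρ x = 0 := Subsingleton.elim _ _
    simp [this]
  | inr h =>
    obtain ⟨v, hv, heig⟩ := hB V (ρ.comp (A.toClosure B)) (by
      let _ := A.units.zariski
      intro v l c
      obtain ⟨f, hf, hfl⟩ := hρ v l
      have hf' : (fun g : Mˣ => f g) ∈ A.units.coord := Algebra.subset_adjoin (Or.inl ⟨f, hf, rfl⟩)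
      convert (A.units.isClosed_fibre hf' c).preimage (continuous_subtype_val (p := (· ∈ B)))
        using 1
      ext b
      simp only [Set.mem_ofPred_eq, Set.mem_preimage, MonoidHom.comp_apply, hfl]
      rfl)
    obtain ⟨l, hl⟩ := Module.Projective.exists_dual_ne_zero K hv
    obtain ⟨f, hf, hfl⟩ := hρ v l
    -- This multiple of the coefficient of `v` is the eigenvalue on `v`, that is, the first diagonal
    -- entry.
    have hχ : (l v)⁻¹ • f ∈ A.coord := A.coord.smul_mem hf _
    set χ : M → K := (l v)⁻¹ • f with hχdef
    have heigen : ∀ x, ρ x v = χ x • v := by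
      intro x
      -- Tested against a functional, the eigenvector equation says that a regular function
      -- vanishes. It does so on `B`, hence on the closure.
      rw [← sub_eq_zero, ← Module.forall_dual_apply_eq_zero_iff K]
      intro l'
      obtain ⟨f', hf', hfl'⟩ := hρ v l'
      have hmem : f' - l' v • χ ∈ A.coord := A.coord.sub_mem hf' (A.coord.smul_mem hχ _)
      have := A.eq_zero_of_mem_closure hmem (S := (fun g : Mˣ => (g : M)) '' (B : Set Mˣ)) ?_ x.2
      · rw [map_sub, map_smul, hfl']
        simpa [mul_comm] using this
      · rintro _ ⟨b, hb, rfl⟩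
        obtain ⟨c, hc⟩ := heig ⟨b, hb⟩
        have h1 := hfl (A.toClosure B ⟨b, hb⟩)
        have h2 := hfl' (A.toClosure B ⟨b, hb⟩)
        rw [MonoidHom.comp_apply] at hc
        rw [hc, map_smul, smul_eq_mul] at h1 h2
        have h1' : c * l v = f b := h1
        have h2' : c * l' v = f' b := h2
        simp only [Pi.sub_apply, Pi.smul_apply, smul_eq_mul, hχdef, ← h1', ← h2']
        field_simp
        ring
    have hle : ∀ x, K ∙ v ≤ (K ∙ v).comap (ρ x) := by
      intro x
      rw [Submodule.span_singleton_le_iff_mem, Submodule.mem_comap, heigen]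
      exact Submodule.smul_mem _ _ (Submodule.mem_span_singleton_self v)
    have hlt : Module.finrank K (V ⧸ (K ∙ v)) < n := by
      have h1 := Submodule.finrank_quotient_add_finrank (K ∙ v)
      rw [finrank_span_singleton hv] at h1
      omega
    -- The remaining diagonal entries come from the quotient by the line, whose coefficients are
    -- coefficients of `V`.
    obtain ⟨T, hT, hmul, hnil⟩ := ih _ hlt (V ⧸ (K ∙ v)) (quotientStable ρ _ hle) (by
      intro w l'
      obtain ⟨w, rfl⟩ := Submodule.mkQ_surjective _ w
      exact hρ w (l' ∘ₗ (K ∙ v).mkQ)) rfl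
    refine ⟨insert χ T, Set.insert_subset hχ hT, ?_, fun x => ?_⟩
    · intro χ' hχ' x y
      rcases Set.mem_insert_iff.1 hχ' with rfl | hχ'
      · have h1 := heigen (x * y)
        rw [map_mul, Module.End.mul_apply, heigen y, map_smul, heigen x, smul_smul] at h1
        rw [mul_comm (χ x)]
        exact (smul_left_injective K hv h1).symm
      · exact hmul χ' hχ' x y
    · rw [isNilpotent_iff_mapQ_span_singleton hv (heigen x) (hle x), Set.forall_mem_insert, ← hnil]
      rfl

/-- An affine monoid with zero has a finite-dimensional representation with regular coefficients
that detects the zero element. -/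
theorem exists_representation.{u, v} {K : Type u} [Field K] {M : Type v} [MonoidWithZero M]
    (A : AffineMonoid K M) :
    ∃ (V : Submodule K (M → K)) (ρ : M →* Module.End K V), FiniteDimensional K V ∧
      (∀ (v : V) (l : Module.Dual K V), ∃ f ∈ A.coord, ∀ x, l (ρ x v) = f x) ∧
      ∀ x, ρ x = 0 ↔ x = 0 := by
  obtain ⟨S, hS⟩ := A.fg
  have hSA : ∀ s ∈ S, s ∈ A.coord := fun s hs => hS ▸ Algebra.subset_adjoin hs
  -- Subtracting `s 0` makes these functions vanish at `0`, so that `0` acts as the zero operator.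
  let τ : (M → K) → M → M → K := fun s m x => s (x * m) - s 0
  let V : Submodule K (M → K) := ⨆ s : S, Submodule.span K (Set.range (τ s))
  have hτ : ∀ s ∈ S, ∀ m, τ s m ∈ V := fun s hs m =>
    le_iSup (fun s : S => Submodule.span K (Set.range (τ s))) ⟨s, hs⟩ (Submodule.subset_span ⟨m, rfl⟩)
  have hind : ∀ W : Submodule K (M → K), (∀ s ∈ S, ∀ m, τ s m ∈ W) → V ≤ W := fun W hW =>
    iSup_le fun s => Submodule.span_le.2 (by
      rintro _ ⟨m, rfl⟩
      exact hW s s.2 m)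
  have hfd : FiniteDimensional K V := by
    have : ∀ s : S, FiniteDimensional K (Submodule.span K (Set.range (τ s))) := by
      intro s
      obtain ⟨W, hW, -, hmem⟩ := A.exists_slices_mem _ (A.mul_regular s (hSA s s.2))
      refine Submodule.finiteDimensional_of_le (S₂ := W ⊔ Submodule.span K {1})
        (Submodule.span_le.2 ?_)
      rintro _ ⟨m, rfl⟩
      refine sub_mem (Submodule.mem_sup_left (hmem m)) (Submodule.mem_sup_right ?_)
      refine Submodule.mem_span_singleton.2 ⟨(s : M → K) 0, ?_⟩
      ext
      simp
    exact Submodule.finiteDimensional_iSup _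
  have hcoord : V ≤ Subalgebra.toSubmodule A.coord := hind _ fun s hs m =>
    A.coord.sub_mem (A.mul_right_mem m (hSA s hs)) (A.coord.algebraMap_mem (s 0))
  have hzero : ∀ f ∈ V, f 0 = 0 := fun f hf =>
    hind (LinearMap.ker (LinearMap.proj (R := K) (φ := fun _ : M => K) 0))
      (fun s _ m => by simp [τ]) hf
  have hstab : ∀ m, ∀ f ∈ V, LinearMap.funLeft K K (fun x : M => x * m) f ∈ V := by
    intro m f hf
    refine hind (V.comap (LinearMap.funLeft K K (fun x : M => x * m))) (fun s hs k => ?_) hf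
    have : LinearMap.funLeft K K (fun x : M => x * m) (τ s k) = τ s (m * k) := by
      ext x
      simp [τ, LinearMap.funLeft_apply, mul_assoc]
    rw [Submodule.mem_comap, this]
    exact hτ s hs _
  let ρ : M →* Module.End K V :=
    { toFun := fun m => (LinearMap.funLeft K K (fun x : M => x * m)).restrict (hstab m)
      map_one' := by
        ext f x
        simp [LinearMap.funLeft_apply]
      map_mul' := fun m k => by
        ext f x
        simp [LinearMap.funLeft_apply, mul_assoc] }
  have hρ : ∀ m (f : V) (x : M), (ρ m f : M → K) x = (f : M → K) (x * m) := fun m f x => rfl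
  refine ⟨V, ρ, hfd, ?_, ?_⟩
  · intro f l
    obtain ⟨l', hl'⟩ := LinearMap.exists_extend l
    refine ⟨_, A.dual_slice_mem _ (A.mul_regular f (hcoord f.2)) l', fun x => ?_⟩
    rw [← hl']
    rfl
  · intro x
    constructor
    · intro hx
      -- Evaluate `ρ x (τ s 1) = 0` at `1`. As the generators separate points, this gives `x = 0`.
      have hgen : ∀ s ∈ S, s x = s 0 := by
        intro s hs
        have h := congrFun (congrArg Subtype.val (LinearMap.congr_fun hx ⟨τ s 1, hτ s hs 1⟩)) 1
        rw [hρ] at h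
        simpa [τ, sub_eq_zero] using h
      refine A.eval_injective _ _ fun f hf => ?_
      rw [← hS] at hf
      induction hf using Algebra.adjoin_induction with
      | mem s hs => exact hgen s hs
      | algebraMap r => rfl
      | add _ _ _ _ h h' => simp [h, h']
      | mul _ _ _ _ h h' => simp [h, h']
    · rintro rfl
      ext f x
      rw [hρ, mul_zero]
      exact hzero f f.2

/-- The nilpotent elements of the closure of a connected solvable subgroup of the unit group are
cut out by regular functions that are multiplicative on that closure. -/
theorem exists_multiplicative_nilpotentPart {K : Type*} [Field K] [IsAlgClosed K] {M : Type*}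
    [MonoidWithZero M] (A : AffineMonoid K M) {B : Subgroup Mˣ}
    (hB : @IsPreconnected Mˣ A.units.zariski (B : Set Mˣ)) (hsol : Group.IsSolvable B) :
    ∃ T : Set (M → K), T ⊆ A.coord ∧
      (∀ χ ∈ T, ∀ x y : A.closureSubmonoid B, χ (x * y) = χ x * χ y) ∧
      A.nilpotentPart B = A.closureOf B ∩ AffineVariety.zeros T := by
  obtain ⟨V, ρ, hfd, hρ, hzero⟩ := A.exists_representation
  obtain ⟨T, hT, hmul, hnil⟩ := A.exists_multiplicative_of_representation
    (A.units.hasCommonEigenvectors hB hsol) V (ρ.comp (A.closureSubmonoid B).subtype) (by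
      intro v l
      obtain ⟨f, hf, hfl⟩ := hρ v l
      exact ⟨f, hf, fun x => hfl x⟩)
  refine ⟨T, hT, hmul, ?_⟩
  ext x
  refine and_congr_right fun hx => ?_
  refine Iff.trans ?_ (hnil ⟨x, hx⟩)
  change _ ↔ IsNilpotent (ρ x)
  constructor
  · rintro ⟨m, -, hm⟩
    exact ⟨m, by rw [← map_pow, hm, (hzero 0).2 rfl]⟩
  · rintro ⟨m, hm⟩
    -- `IsNilpotent` allows exponent `0`, whereas `nilpotentPart` asks for a positive one.
    refine ⟨m + 1, m.succ_pos, ?_⟩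
    rw [← map_pow, hzero] at hm
    rw [pow_succ, hm, zero_mul]

end AffineMonoid

/-- If one factor of a product in the closure of `B` is killed by every multiplicative function in
`T`, so is the product. This ideal property gives stability under multiplication and under `B × B`,
since `B` lies in its closure. -/
theorem corollary7p3 {M : Type*} [MonoidWithZero M] (A : AffineMonoid ℂ M) (hM : A.IsReductive)
    (B : Subgroup Mˣ) (hB : A.units.IsBorel B) :
    A.IsAlgebraicSubsemigroup (A.nilpotentPart B) ∧
      AffineMonoid.IsBiStable B (A.nilpotentPart B) := by
  obtain ⟨⟨⟨-, hconn⟩, hsol⟩, -⟩ := hB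
  obtain ⟨T, hT, hmul, heq⟩ := A.exists_multiplicative_nilpotentPart hconn.2 hsol
  rw [heq]
  refine ⟨⟨?_, ?_⟩, ?_⟩
  · let _ := A.zariski
    exact isClosed_closure.inter (A.isClosed_zeros hT)
  · rintro x ⟨hx, hx0⟩ y ⟨hy, -⟩
    refine ⟨(A.closureSubmonoid B).mul_mem hx hy, fun χ hχ => ?_⟩
    rw [hmul χ hχ ⟨x, hx⟩ ⟨y, hy⟩]
    simp [hx0 χ hχ]
  · rintro b₁ hb₁ b₂ hb₂ x ⟨hx, hx0⟩
    have h₁ := (A.toClosure B ⟨b₁, hb₁⟩).2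
    have h₂ := (A.toClosure B ⟨b₂⁻¹, B.inv_mem hb₂⟩).2
    have h₃ := (A.closureSubmonoid B).mul_mem h₁ hx
    refine ⟨(A.closureSubmonoid B).mul_mem h₃ h₂, fun χ hχ => ?_⟩
    have e₁ := hmul χ hχ ⟨_, h₃⟩ ⟨_, h₂⟩
    have e₂ := hmul χ hχ ⟨_, h₁⟩ ⟨x, hx⟩
    simp only [hx0 χ hχ, mul_zero] at e₂
    rw [e₂, zero_mul] at e₁
    exact e₁
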